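/- Conventions. For a real Banach space $X$ with dual $X^*$, $B(x,r)$ is the open ball, $\mathbf B_{X^*}$ the closed unit ball of $X^*$, $d(x,S)=\inf_{y\in S}\|x-y\|$, and a real Banach space is Asplund if every continuous convex real-valued function on it is Fréchet differentiable at each point of a dense subset. For $A\subseteq X$ closed, $x\in A$ and $\varepsilon\ge 0$, put $$\hat N_\varepsilon(A,x)=\Big\{x^*\in X^*:\ \limsup_{y\to x,\ y\in A,\ y\ne x}\frac{\langle x^*,y-x\rangle}{\|y-x\|}\le\varepsilon\Big\},$$ and let $\hat N(A,x)=\hat N_0(A,x)$ be the Fréchet normal cone. The limiting normal cone $N(A,x)$ is the set of all $x^*\in X^*$ for which there are $x_n\in A$, $\varepsilon_n\ge 0$ and $x_n^*\in\hat N_{\varepsilon_n}(A,x_n)$ with $x_n\to x$, $\varepsilon_n\to 0$ and $x_n^*\to x^*$ weak$^*$. For closed sets $A_1,\dots,A_m$ with $A=\bigcap_{i=1}^m A_i\ne\emptyset$: - $\{A_1,\dots,A_m\}$ is subtransversal at $\bar x\in A$ if there are $\tau,r>0$ with $d(x,A)\le\tau\sum_{i=1}^m d(x,A_i)$ for all $x\in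 B(\bar x,r)$; - it has the strong Fréchet CHIP at $x\in A$ if $\hat N(A,x)\subseteq\sum_{i=1}^m\hat N(A_i,x)$, and the strong limiting CHIP at $x\in A$ if $N(A,x)\subseteq\sum_{i=1}^m N(A_i,x)$; - cones $P_1,\dots,P_m\subseteq X^*$ have property (G) with constant $\tau>0$ if $\big(\sum_{i=1}^m P_i\big)\cap\mathbf B_{X^*}\subseteq\tau\sum_{i=1}^m(P_i\cap\mathbf B_{X^*})$. Theorem. Let $X$ be a real Banach space, $Y$ an Asplund space, $f:X\to Y$ continuously differentiable, and $C_1,\dots,C_m$ closed convex subsets of $Y$ with $\bigcap_{i=1}^m C_i\neq\emptyset$. Let $A_i=f^{-1}(C_i)$, $A=\bigcap_{i=1}^m A_i$, and let $\bar x\in A$ be such that $\nabla f(\bar x)$ is surjective. Then the following statements are equivalent: (i) $\{A_1,\dots,A_m\}$ is subtransversal at $\bar x$; (ii) there exist $\tau,\delta>0$ such that for all $x\in A\cap B(\bar x,\delta)$, $\{A_1,\dots,A_m\}$ has the strong Fréchet CHIP at $x$ and $\{\hat N(A_1,x),\dots,\hat N(A_m,x)\}$ has property (G) with constant $\tau$;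 (iii) there exist $\tau,\delta>0$ such that for all $x\in A\cap B(\bar x,\delta)$, $\{A_1,\dots,A_m\}$ has the strong limiting CHIP at $x$ and $\{N(A_1,x),\dots,N(A_m,x)\}$ has property (G) with constant $\tau$. -/

import Mathlib

open Set Filter Topology Metric
open scoped Pointwise

/-- A real Banach space `Y` is Asplund if every continuous convex function on `Y` is Fréchet
differentiable at each point of a dense subset of `Y`. -/
def IsAsplund (Y : Type*) [NormedAddCommGroup Y] [NormedSpace ℝ Y] : Prop :=
  CompleteSpace Y ∧
    ∀ g : Y → ℝ, Continuous g → ConvexOn ℝ univ g → Dense {y : Y | DifferentiableAt ℝ g y}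

section Normals

variable {X : Type*} [NormedAddCommGroup X] [NormedSpace ℝ X]

/-- The set of `ε`-normals to `A` at `x ∈ A`: the functionals `φ` with
`limsup φ (y - x) / ‖y - x‖ ≤ ε` as `y → x`, `y ∈ A`, `y ≠ x`. The upper limit is taken in the
extended reals, so that it is `-∞` when `x` is isolated in `A`. -/
def epsNormals (ε : ℝ) (A : Set X) (x : X) : Set (StrongDual ℝ X) :=
  {φ | limsup (fun y : X => ((φ (y - x) / ‖y - x‖ : ℝ) : EReal)) (𝓝[A \ {x}] x) ≤ (ε : EReal)}

/-- The Fréchet normal cone to `A` at `x ∈ A`. -/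
def frechetNormalCone (A : Set X) (x : X) : Set (StrongDual ℝ X) :=
  epsNormals 0 A x

/-- The limiting (Mordukhovich) normal cone to `A` at `x ∈ A`: the sequential weak-star limits of
`εₙ`-normals to `A` at points `xₙ ∈ A` with `xₙ → x` and `εₙ ↓ 0`. -/
def limitingNormalCone (A : Set X) (x : X) : Set (StrongDual ℝ X) :=
  {φ | ∃ (u : ℕ → X) (ε : ℕ → ℝ) (ψ : ℕ → StrongDual ℝ X),
    (∀ n, u n ∈ A) ∧ (∀ n, 0 ≤ ε n) ∧ (∀ n, ψ n ∈ epsNormals (ε n) A (u n)) ∧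
    Tendsto u atTop (𝓝 x) ∧ Tendsto ε atTop (𝓝 0) ∧
    Tendsto (fun n => StrongDual.toWeakDual (ψ n)) atTop (𝓝 (StrongDual.toWeakDual φ))}

variable {m : ℕ}

/-- The strong Fréchet conical hull intersection property of `A₁, …, Aₘ` at `x ∈ ⋂ Aᵢ`. -/
def StrongFrechetCHIPAt (A : Fin m → Set X) (x : X) : Prop :=
  frechetNormalCone (⋂ i, A i) x ⊆ ∑ i, frechetNormalCone (A i) x

/-- The strong limiting conical hull intersection property of `A₁, …, Aₘ` at `x ∈ ⋂ Aᵢ`. -/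
def StrongLimitingCHIPAt (A : Fin m → Set X) (x : X) : Prop :=
  limitingNormalCone (⋂ i, A i) x ⊆ ∑ i, limitingNormalCone (A i) x

/-- Property (G) of the sets (in the applications: cones) `P₁, …, Pₘ` with constant `τ`. -/
def PropertyGWith (τ : ℝ) (P : Fin m → Set X) : Prop :=
  (∑ i, P i) ∩ closedBall 0 1 ⊆ τ • ∑ i, (P i ∩ closedBall 0 1)

/-- Subtransversality of `A₁, …, Aₘ` at a point `xbar` of `⋂ Aᵢ`. -/
def SubtransversalAt (A : Fin m → Set X) (xbar : X) : Prop :=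
  ∃ τ > (0 : ℝ), ∃ r > (0 : ℝ), ∀ x ∈ ball xbar r,
    infDist x (⋂ i, A i) ≤ τ * ∑ i, infDist x (A i)

end Normals

/-! Near `xbar` the derivative of `f` stays surjective with a uniformly bounded right inverse and `f`
itself is metrically regular (`RegularNear`), so the statement for the preimages `f ⁻¹' C i` reduces
to one about the convex sets `C i` themselves.

On the primal side, distances to `f ⁻¹' S` and to `S` are comparable, so subtransversality of the
preimages is a linear error bound for the `C i` near `f xbar`
(`RegularNear.subtransversalAt_iff`). On the dual side, for convex `S` every weak-star limit of
`ε`-normals to `f ⁻¹' S` is a convex normal to `S` composed with the derivative. Hence the Fréchet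
and the limiting normal cones coincide near `xbar` (`RegularNear.limitingNormalCone_preimage`),
which makes the two dual conditions equivalent. Composition with the derivative is injective and
distorts norms by bounded factors, so the strong CHIP together with property (G) means that normals
to `⋂ i, C i` decompose boundedly into normals to the `C i` (`BoundedDecomposition`).

For convex sets the error bound and the bounded decomposition are equivalent. If the error bound
holds, a normal to the intersection at `y` is dominated by a multiple of the sum of the distances to
the cones generated by the `C i - y`, and it splits by the Hahn–Banach theorem
(`boundedDecomposition_of_errorBound`). Conversely, Ekeland's variational principle provides, for `y`
outside the intersection, a point `c` of it with a unit normal that makes a uniformly acute angle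
with `y - c`; each summand of this normal takes at `y - c` a value at most a multiple of the
distance from `y` to the corresponding set (`errorBound_of_boundedDecomposition`). -/

/-! ### Normal cones to convex sets -/

section ConvexSets

variable {Y : Type*} [NormedAddCommGroup Y] [NormedSpace ℝ Y]

/-- The normal cone of convex analysis to `C` at `y`: the functionals that attain their supremum
over `C` at `y`. -/
def convexNormalCone (C : Set Y) (y : Y) : Set (StrongDual ℝ Y) :=
  {ψ | ∀ c ∈ C, ψ (c - y) ≤ 0}

/-- Every element `φ` of `P` is a sum of elements of the `Q i` whose norms are at most `τ * ‖φ‖`.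
When `P` is the normal cone to an intersection and the `Q i` are the normal cones to the
individual sets, this is the conjunction of the strong CHIP with property (G). -/
def BoundedDecomposition {ι : Type*} [Fintype ι] (τ : ℝ) (P : Set (StrongDual ℝ Y))
    (Q : ι → Set (StrongDual ℝ Y)) : Prop :=
  ∀ φ ∈ P, ∃ ψ : ι → StrongDual ℝ Y, (∀ i, ψ i ∈ Q i ∧ ‖ψ i‖ ≤ τ * ‖φ‖) ∧ ∑ i, ψ i = φ

theorem smul_mem_convexNormalCone {C : Set Y} {y : Y} {ψ : StrongDual ℝ Y}
    (hψ : ψ ∈ convexNormalCone C y) {t : ℝ} (ht : 0 ≤ t) : t • ψ ∈ convexNormalCone C y :=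
  fun c hc => by simpa using mul_nonpos_of_nonneg_of_nonpos ht (hψ c hc)

theorem zero_mem_convexNormalCone (C : Set Y) (y : Y) : 0 ∈ convexNormalCone C y :=
  fun c _ => by simp

theorem apply_sub_le_norm_mul_infDist {C : Set Y} {y : Y} {ψ : StrongDual ℝ Y}
    (hψ : ψ ∈ convexNormalCone C y) (hC : C.Nonempty) (z : Y) :
    ψ (z - y) ≤ ‖ψ‖ * infDist z C := by
  have key : ∀ c ∈ C, ψ (z - y) ≤ ‖ψ‖ * dist z c := by
    intro c hc
    have h1 : ψ (z - y) = ψ (z - c) + ψ (c - y) := by rw [← map_add]; simp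
    have h2 : ψ (z - c) ≤ ‖ψ‖ * ‖z - c‖ := (le_abs_self _).trans (ψ.le_opNorm _)
    rw [dist_eq_norm]
    linarith [hψ c hc]
  rcases (norm_nonneg ψ).eq_or_lt with h0 | h0
  · obtain ⟨c, hc⟩ := hC
    simpa [← h0] using key c hc
  · rw [mul_comm, ← div_le_iff₀ h0]
    refine (le_infDist hC).2 fun c hc => ?_
    rw [div_le_iff₀ h0, mul_comm]
    exact key c hc

/-- For families of cones, the strong CHIP inclusion together with property (G) says that every
element of `P` decomposes boundedly. -/
theorem subset_sum_and_propertyG_iff {m : ℕ} {τ : ℝ} (hτ : 0 < τ) {P : Set (StrongDual ℝ Y)}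
    {Q : Fin m → Set (StrongDual ℝ Y)} (hzero : ∀ i, 0 ∈ Q i)
    (hsmul : ∀ i, ∀ ψ ∈ Q i, ∀ t : ℝ, 0 ≤ t → t • ψ ∈ Q i) (hsum : ∑ i, Q i ⊆ P) :
    (P ⊆ ∑ i, Q i ∧ PropertyGWith τ Q) ↔ BoundedDecomposition τ P Q := by
  constructor
  · rintro ⟨hP, hG⟩ φ hφ
    rcases eq_or_ne φ 0 with rfl | hne
    · exact ⟨0, fun i => ⟨hzero i, by simp⟩, by simp⟩
    have hn : 0 < ‖φ‖ := norm_pos_iff.2 hne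
    have hmem : ‖φ‖⁻¹ • φ ∈ (∑ i, Q i) ∩ closedBall 0 1 := by
      refine ⟨?_, by simp [norm_smul, hn.ne']⟩
      obtain ⟨g, hg, hgs⟩ := (Set.mem_fintype_sum _ _).1 (hP hφ)
      refine (Set.mem_fintype_sum _ _).2
        ⟨fun i => ‖φ‖⁻¹ • g i, fun i => hsmul i _ (hg i) _ (by positivity), ?_⟩
      rw [← Finset.smul_sum, hgs]
    obtain ⟨ψ, hψ, hψe⟩ := hG hmem
    obtain ⟨g, hg, hgs⟩ := (Set.mem_fintype_sum _ _).1 hψ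
    refine ⟨fun i => (‖φ‖ * τ) • g i, fun i => ⟨hsmul i _ (hg i).1 _ (by positivity), ?_⟩, ?_⟩
    · have h1 : ‖g i‖ ≤ 1 := by simpa using (hg i).2
      rw [norm_smul, Real.norm_of_nonneg (by positivity), mul_comm τ]
      exact mul_le_of_le_one_right (by positivity) h1
    · rw [← Finset.smul_sum, hgs, mul_smul]
      have : τ • ψ = ‖φ‖⁻¹ • φ := hψe
      rw [this, smul_smul, mul_inv_cancel₀ hn.ne', one_smul]
  · intro h
    refine ⟨fun φ hφ => ?_, fun φ hφ => ?_⟩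
    · obtain ⟨ψ, hψ, hs⟩ := h φ hφ
      exact (Set.mem_fintype_sum _ _).2 ⟨ψ, fun i => (hψ i).1, hs⟩
    · obtain ⟨ψ, hψ, hs⟩ := h φ (hsum hφ.1)
      have h1 : ‖φ‖ ≤ 1 := by simpa using hφ.2
      refine ⟨τ⁻¹ • φ, (Set.mem_fintype_sum _ _).2
        ⟨fun i => τ⁻¹ • ψ i, fun i => ⟨hsmul i _ (hψ i).1 _ (by positivity), ?_⟩, ?_⟩, ?_⟩
      · have h2 : ‖ψ i‖ ≤ τ := (hψ i).2.trans (mul_le_of_le_one_right hτ.le h1)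
        rw [mem_closedBall_zero_iff, norm_smul, norm_inv, Real.norm_of_nonneg hτ.le]
        rwa [inv_mul_le_iff₀ hτ, mul_one]
      · rw [← Finset.smul_sum, hs]
      · simp [smul_smul, hτ.ne']

/-! ### From an error bound to decompositions of normals -/

/-- A continuous functional below a sum of continuous sublinear functions splits into functionals
below the summands: extend it from the diagonal of `ι → Y` by the Hahn–Banach theorem. -/
theorem exists_sum_eq_of_le_sum_sublinear {ι : Type*} [Fintype ι] {p : ι → Y → ℝ} {K : ℝ}
    (hom : ∀ i, ∀ c : ℝ, 0 < c → ∀ v, p i (c • v) = c * p i v)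
    (add : ∀ i v w, p i (v + w) ≤ p i v + p i w) (bound : ∀ i v, p i v ≤ K * ‖v‖)
    {ψ : StrongDual ℝ Y} (hψ : ∀ v, ψ v ≤ ∑ i, p i v) :
    ∃ g : ι → StrongDual ℝ Y, (∀ i v, g i v ≤ p i v) ∧ ∑ i, g i = ψ := by
  classical
  rcases isEmpty_or_nonempty ι with hι | ⟨⟨i₀⟩⟩
  · refine ⟨0, fun i => isEmptyElim i, ?_⟩
    ext v
    have h1 := hψ v
    have h2 := hψ (-v)
    simp only [Finset.univ_eq_empty, Finset.sum_empty, map_neg] at h1 h2 ⊢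
    simp only [_root_.zero_apply]
    linarith
  let D : Submodule ℝ (ι → Y) := LinearMap.range (LinearMap.pi fun _ : ι => LinearMap.id)
  -- On the diagonal, evaluation at any one coordinate `i₀` recovers the common value.
  let F : (ι → Y) →ₗ.[ℝ] ℝ := ⟨D, (ψ.toLinearMap ∘ₗ LinearMap.proj i₀) ∘ₗ D.subtype⟩
  obtain ⟨G, hGF, hG⟩ := exists_extension_of_le_sublinear F (fun v => ∑ i, p i (v i))
    (fun c hc v => by simp [hom _ c hc, Finset.mul_sum])
    (fun v w => by
      rw [← Finset.sum_add_distrib]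
      exact Finset.sum_le_sum fun i _ => add i _ _)
    (by
      rintro ⟨_, v, rfl⟩
      exact hψ v)
  have p_zero : ∀ i, p i 0 = 0 := fun i => by
    have := hom i 2 (by norm_num) 0
    rw [smul_zero] at this
    linarith
  have hsingle : ∀ i v, G (Pi.single i v) ≤ p i v := fun i v => by
    refine (hG _).trans_eq ?_
    rw [Finset.sum_eq_single i]
    · simp
    · intro j _ hj
      simp [hj, p_zero]
    · simp
  have hnorm : ∀ i v, ‖(G ∘ₗ LinearMap.single ℝ (fun _ : ι => Y) i) v‖ ≤ K * ‖v‖ := fun i v => by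
    rw [Real.norm_eq_abs, abs_le]
    have h1 := (hsingle i v).trans (bound i v)
    have h2 := (hsingle i (-v)).trans (bound i (-v))
    rw [Pi.single_neg, map_neg, norm_neg] at h2
    simp only [LinearMap.comp_apply, LinearMap.coe_single]
    constructor <;> linarith
  refine ⟨fun i => (G ∘ₗ LinearMap.single ℝ (fun _ : ι => Y) i).mkContinuous K (hnorm i),
    fun i v => hsingle i v, ?_⟩
  ext v
  have h1 : G (fun _ => v) = ψ v := hGF ⟨fun _ => v, v, rfl⟩
  rw [← h1]
  simp only [_root_.sum_apply, LinearMap.mkContinuous_apply, LinearMap.comp_apply,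
    LinearMap.coe_single]
  rw [← map_sum, Finset.univ_sum_single (fun _ : ι => v)]

theorem infDist_smul_cone (T : ConvexCone ℝ Y) {c : ℝ} (hc : 0 < c) (v : Y) :
    infDist (c • v) (T : Set Y) = c * infDist v (T : Set Y) := by
  have h : c • (T : Set Y) = T := by
    ext w
    rw [mem_smul_set_iff_inv_smul_mem₀ hc.ne']
    exact T.smul_mem_iff (inv_pos.2 hc)
  conv_lhs => rw [← h, infDist_smul₀ hc.ne', Real.norm_of_nonneg hc.le]

theorem infDist_add_cone_le (T : ConvexCone ℝ Y) (hT : (T : Set Y).Nonempty) (v w : Y) :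
    infDist (v + w) (T : Set Y) ≤ infDist v (T : Set Y) + infDist w (T : Set Y) := by
  refine le_of_forall_pos_le_add fun η hη => ?_
  obtain ⟨a, ha, hva⟩ := (infDist_lt_iff hT).1 (lt_add_of_pos_right (infDist v (T : Set Y))
    (half_pos hη))
  obtain ⟨b, hb, hwb⟩ := (infDist_lt_iff hT).1 (lt_add_of_pos_right (infDist w (T : Set Y))
    (half_pos hη))
  calc infDist (v + w) (T : Set Y) ≤ dist (v + w) (a + b) := infDist_le_dist_of_mem (T.add_mem ha hb)
    _ ≤ dist v a + dist w b := dist_add_add_le _ _ _ _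
    _ ≤ _ := by linarith

/-- A local linear error bound around `y` makes the normals to the intersection at `y` decompose
boundedly. The distances to the cones generated by the `C i - y` are sublinear functions dominating
a given normal, so the normal splits by the Hahn–Banach theorem. -/
theorem boundedDecomposition_of_errorBound {ι : Type*} [Fintype ι] {C : ι → Set Y}
    (hconv : ∀ i, Convex ℝ (C i)) {y : Y} (hy : y ∈ ⋂ i, C i) {τ : ℝ} (hτ : 0 ≤ τ)
    (herr : ∀ᶠ z in 𝓝 y, infDist z (⋂ i, C i) ≤ τ * ∑ i, infDist z (C i)) :
    BoundedDecomposition τ (convexNormalCone (⋂ i, C i) y) (fun i => convexNormalCone (C i) y) := by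
  intro ψ hψ
  have hyi : ∀ i, y ∈ C i := mem_iInter.1 hy
  have hconv' : ∀ i, Convex ℝ ((fun v => y + v) ⁻¹' C i) := fun i =>
    (hconv i).translate_preimage_right y
  let T : ι → ConvexCone ℝ Y := fun i => ConvexCone.hull ℝ ((fun v => y + v) ⁻¹' C i)
  have hT0 : ∀ i, (0 : Y) ∈ (T i : Set Y) := fun i =>
    (ConvexCone.mem_hull_of_convex (hconv' i)).2 ⟨1, one_pos, 0, by simpa using hyi i, by simp⟩
  have hκ : 0 ≤ τ * ‖ψ‖ := by positivity
  -- Short multiples of an element of the cone stay in `C i - y`, so that the error bound applies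
  -- to short multiples of `v`.
  have hle : ∀ v, ψ v ≤ ∑ i, τ * ‖ψ‖ * infDist v (T i : Set Y) := by
    intro v
    have hlim : ∀ η > 0, ψ v ≤ τ * ‖ψ‖ * ∑ i, (infDist v (T i : Set Y) + η) := by
      intro η hη
      have hex : ∀ i, ∃ k ∈ (T i : Set Y), dist v k < infDist v (T i : Set Y) + η := fun i =>
        (infDist_lt_iff ⟨0, hT0 i⟩).1 (lt_add_of_pos_right _ hη)
      choose k hkT hk using hex
      have hsmall : ∀ i, ∀ᶠ t : ℝ in 𝓝[>] 0, y + t • k i ∈ C i := by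
        intro i
        obtain ⟨s, hs, w, hw, hsw⟩ := (ConvexCone.mem_hull_of_convex (hconv' i)).1 (hkT i)
        replace hsw : s • w = k i := hsw
        filter_upwards [Ioo_mem_nhdsGT (inv_pos.2 hs)] with t ht
        have hts : t * s ≤ 1 := by
          have := mul_le_mul_of_nonneg_right ht.2.le hs.le
          rwa [inv_mul_cancel₀ hs.ne'] at this
        have hw' : y + w ∈ C i := hw
        have := (hconv i).add_smul_sub_mem (hyi i) hw' ⟨mul_nonneg ht.1.le hs.le, hts⟩
        rwa [add_sub_cancel_left, mul_smul, hsw] at this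
      have hcont : Tendsto (fun t : ℝ => y + t • v) (𝓝[>] 0) (𝓝 y) := by
        have : Continuous fun t : ℝ => y + t • v := by fun_prop
        simpa using (this.tendsto 0).mono_left nhdsWithin_le_nhds
      obtain ⟨t, ht0, hterr, htk⟩ := (eventually_mem_nhdsWithin.and
        ((hcont.eventually herr).and (eventually_all.2 hsmall))).exists
      replace ht0 : 0 < t := ht0
      have h1 := apply_sub_le_norm_mul_infDist hψ ⟨y, hy⟩ (y + t • v)
      rw [add_sub_cancel_left, map_smul, smul_eq_mul] at h1
      have h2 : ∀ i, infDist (y + t • v) (C i) ≤ t * (infDist v (T i : Set Y) + η) := fun i => by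
        refine (infDist_le_dist_of_mem (htk i)).trans ?_
        rw [dist_add_left, dist_smul₀, Real.norm_of_nonneg ht0.le]
        exact mul_le_mul_of_nonneg_left (hk i).le ht0.le
      have h3 : t * ψ v ≤ t * (τ * ‖ψ‖ * ∑ i, (infDist v (T i : Set Y) + η)) := by
        calc t * ψ v ≤ ‖ψ‖ * (τ * ∑ i, infDist (y + t • v) (C i)) :=
              h1.trans (mul_le_mul_of_nonneg_left hterr (norm_nonneg _))
          _ ≤ ‖ψ‖ * (τ * ∑ i, t * (infDist v (T i : Set Y) + η)) := by
              gcongr with i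
              exact h2 i
          _ = _ := by rw [← Finset.mul_sum]; ring
      exact le_of_mul_le_mul_left h3 ht0
    have hc : Tendsto (fun η : ℝ => τ * ‖ψ‖ * ∑ i, (infDist v (T i : Set Y) + η)) (𝓝[>] 0)
        (𝓝 (τ * ‖ψ‖ * ∑ i, infDist v (T i : Set Y))) := by
      have : Continuous fun η : ℝ => τ * ‖ψ‖ * ∑ i, (infDist v (T i : Set Y) + η) := by fun_prop
      simpa using (this.tendsto 0).mono_left nhdsWithin_le_nhds
    rw [← Finset.mul_sum]
    exact ge_of_tendsto hc (by filter_upwards [self_mem_nhdsWithin] with η hη using hlim η hη)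
  obtain ⟨g, hg, hgs⟩ := exists_sum_eq_of_le_sum_sublinear (K := τ * ‖ψ‖)
    (p := fun i v => τ * ‖ψ‖ * infDist v (T i : Set Y))
    (fun i c hc v => by simp only [infDist_smul_cone (T i) hc]; ring)
    (fun i v w => by
      rw [← mul_add]
      exact mul_le_mul_of_nonneg_left (infDist_add_cone_le (T i) ⟨0, hT0 i⟩ v w) hκ)
    (fun i v => mul_le_mul_of_nonneg_left
      ((infDist_le_dist_of_mem (hT0 i)).trans_eq (dist_zero_right v)) hκ) hle
  have hgn : ∀ i v, g i v ≤ τ * ‖ψ‖ * ‖v‖ := fun i v => (hg i v).trans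
    (mul_le_mul_of_nonneg_left ((infDist_le_dist_of_mem (hT0 i)).trans_eq (dist_zero_right v)) hκ)
  refine ⟨g, fun i => ⟨fun c hc => ?_, ?_⟩, hgs⟩
  · have hmem : c - y ∈ (T i : Set Y) :=
      (ConvexCone.mem_hull_of_convex (hconv' i)).2 ⟨1, one_pos, c - y, by simpa using hc, by simp⟩
    simpa [infDist_zero_of_mem hmem] using hg i (c - y)
  · refine ContinuousLinearMap.opNorm_le_bound _ hκ fun v => ?_
    rw [Real.norm_eq_abs, abs_le]
    have h2 := hgn i (-v)
    rw [map_neg, norm_neg] at h2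
    exact ⟨by linarith, hgn i v⟩

/-! ### Approximate projections onto closed convex sets -/

/-- Ekeland's variational principle, for a nonnegative continuous function on a closed set. -/
theorem exists_ekeland_point {M : Type*} [MetricSpace M] [CompleteSpace M] {S : Set M}
    (hS : IsClosed S) {g : M → ℝ} (hg : Continuous g) (hg0 : ∀ z, 0 ≤ g z) {a : M} (ha : a ∈ S)
    {ε : ℝ} (hε : 0 < ε) :
    ∃ c ∈ S, g c ≤ g a ∧ ∀ z ∈ S, g c ≤ g z + ε * dist z c := by
  let R : M → Set M := fun c => {z | z ∈ S ∧ g z + ε * dist z c ≤ g c}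
  have hself : ∀ c ∈ S, c ∈ R c := fun c hc => ⟨hc, by simp⟩
  have htrans : ∀ {b c z}, c ∈ R b → z ∈ R c → z ∈ R b := fun {b c z} hc hz =>
    ⟨hz.1, by
      have h1 := mul_le_mul_of_nonneg_left (dist_triangle z c b) hε.le
      linarith [hc.2, hz.2]⟩
  have hclosed : ∀ c, IsClosed (R c) := fun c =>
    hS.inter (isClosed_le (hg.add (continuous_const.mul (continuous_id.dist continuous_const)))
      continuous_const)
  have hstep : ∀ (n : ℕ) (c : S), ∃ c' : S, c'.1 ∈ R c ∧ ∀ z ∈ R c, g c' ≤ g z + (1 / 2) ^ n := by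
    intro n c
    have hne : (g '' R c).Nonempty := ⟨_, mem_image_of_mem g (hself c c.2)⟩
    have hbdd : BddBelow (g '' R c) := ⟨0, by rintro _ ⟨z, -, rfl⟩; exact hg0 z⟩
    obtain ⟨_, ⟨c', hc', rfl⟩, hlt⟩ := Real.lt_sInf_add_pos hne
      (show (0 : ℝ) < (1 / 2) ^ n by positivity)
    exact ⟨⟨c', hc'.1⟩, hc', fun z hz => hlt.le.trans
      (add_le_add_left (csInf_le hbdd (mem_image_of_mem g hz)) _)⟩
  choose next hnext hmin using hstep
  let u : ℕ → S := fun n => Nat.rec ⟨a, ha⟩ (fun n c => next n c) n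
  have hu : ∀ n : ℕ, (u (n + 1)).1 ∈ R (u n).1 := fun n => hnext n (u n)
  have hmono : ∀ n k : ℕ, (u (n + k)).1 ∈ R (u n).1 := by
    intro n k
    induction k with
    | zero => exact hself _ (u n).2
    | succ k ih => exact htrans ih (hu (n + k))
  have hdist : ∀ n : ℕ, ∀ z ∈ R (u (n + 1)).1, dist z (u (n + 1)).1 ≤ (1 / 2) ^ n / ε := by
    intro n z hz
    rw [le_div_iff₀ hε, mul_comm]
    have h1 : g (u (n + 1)).1 ≤ g z + (1 / 2) ^ n := hmin n (u n) z (htrans (hu n) hz)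
    linarith [hz.2]
  have hcauchy : CauchySeq fun n : ℕ => (u (n + 1)).1 := by
    refine cauchySeq_of_le_geometric (1 / 2) ε⁻¹ (by norm_num) fun n => ?_
    rw [dist_comm, mul_comm, ← div_eq_mul_inv]
    exact hdist n _ (hu (n + 1))
  obtain ⟨c, hc⟩ := cauchySeq_tendsto_of_complete hcauchy
  have hc' : Tendsto (fun n : ℕ => (u n).1) atTop (𝓝 c) := (tendsto_add_atTop_iff_nat 1).1 hc
  have hcR : ∀ n : ℕ, c ∈ R (u n).1 := fun n =>
    (hclosed _).mem_of_tendsto hc' (by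
      filter_upwards [eventually_ge_atTop n] with k hk
      obtain ⟨j, rfl⟩ := Nat.exists_eq_add_of_le hk
      exact hmono n j)
  refine ⟨c, (hcR 0).1, ?_, fun z hz => ?_⟩
  · have h1 : g c + ε * dist c a ≤ g a := (hcR 0).2
    nlinarith [dist_nonneg (x := c) (y := a)]
  · by_contra! hlt
    have hzR : z ∈ R c := ⟨hz, hlt.le⟩
    have hlim : Tendsto (fun n : ℕ => ((1 : ℝ) / 2) ^ n / ε) atTop (𝓝 0) := by
      simpa using (tendsto_pow_atTop_nhds_zero_of_lt_one (by norm_num : (0 : ℝ) ≤ 1 / 2)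
        (by norm_num)).div_const ε
    have hzc : dist z c ≤ 0 := le_of_tendsto_of_tendsto (tendsto_const_nhds.dist hc) hlim
      (Eventually.of_forall fun n => hdist n z (htrans (hcR (n + 1)) hzR))
    rw [dist_le_zero.1 hzc] at hlt
    simp at hlt

/-- A point `y` outside a closed convex set has an approximate projection `c` onto it, at which
some unit normal makes a uniformly acute angle with `y - c`. An exact projection need not exist, so
`c` minimizes a perturbed distance, and the normal separates the set from the points where the
perturbed distance would be smaller. -/
theorem exists_normal_at_approximate_projection [CompleteSpace Y] {C : Set Y} (hC : IsClosed C)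
    (hconv : Convex ℝ C) {a y : Y} (ha : a ∈ C) (hy : y ∉ C) :
    ∃ c ∈ C, ‖y - c‖ ≤ ‖y - a‖ ∧
      ∃ ψ ∈ convexNormalCone C c, ‖ψ‖ = 1 ∧ ‖y - c‖ ≤ 2 * ψ (y - c) := by
  obtain ⟨c, hc, hca, hmin⟩ := exists_ekeland_point (g := fun z => ‖y - z‖) hC (by fun_prop)
    (fun _ => norm_nonneg _) ha (ε := 1 / 4) (by norm_num)
  refine ⟨c, hc, hca, ?_⟩
  set v := y - c with hv
  have hv0 : 0 < ‖v‖ := norm_pos_iff.2 (sub_ne_zero.2 fun h => hy (h ▸ hc))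
  -- By minimality of `c`, this open convex set is disjoint from `C - c`, and it contains the
  -- segment `(0, v]` as well as the ball of radius `‖v‖ / 2` around `v`, the weight `1 / 4` being
  -- small enough for the latter.
  let U : Set Y := {w | ‖v - w‖ + 1 / 4 * ‖w‖ < ‖v‖}
  let K : Set Y := (fun w => c + w) ⁻¹' C
  have hUconv : Convex ℝ U := by
    have h1 : ConvexOn ℝ univ fun w : Y => dist w v := convexOn_dist v convex_univ
    have h2 : ConvexOn ℝ univ fun w : Y => (1 / 4 : ℝ) • ‖w‖ :=
      (convexOn_norm convex_univ).smul (by norm_num)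
    have h3 := (h1.add h2).convex_lt ‖v‖
    convert h3 using 1
    ext w
    simp [U, dist_eq_norm, norm_sub_rev]
  have hUopen : IsOpen U := isOpen_lt (by fun_prop) continuous_const
  have hdisj : Disjoint U K := by
    rw [Set.disjoint_left]
    intro w hw hwK
    have h1 := hmin _ hwK
    simp only [dist_self_add_left, U, mem_ofPred_eq] at h1 hw
    rw [show y - (c + w) = v - w by rw [hv]; abel] at h1
    linarith
  obtain ⟨n, s, hnU, hnK⟩ := geometric_hahn_banach_open hUconv hUopen
    ((hconv.translate_preimage_right c)) hdisj
  have hs0 : s ≤ 0 := by simpa using hnK 0 (by simpa [K] using hc)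
  have hsegment : ∀ t : ℝ, 0 < t → t ≤ 1 → t • v ∈ U := by
    intro t ht0 ht1
    have h1 : v - t • v = (1 - t) • v := by rw [sub_smul, one_smul]
    simp only [U, mem_ofPred_eq]
    rw [h1, norm_smul, norm_smul, Real.norm_of_nonneg ht0.le,
      Real.norm_of_nonneg (sub_nonneg.2 ht1)]
    nlinarith [mul_pos ht0 hv0]
  have hs : 0 ≤ s := by
    have hlim : Tendsto (fun t : ℝ => n (t • v)) (𝓝[>] 0) (𝓝 0) := by
      have : Continuous fun t : ℝ => n (t • v) := by fun_prop
      simpa using (this.tendsto 0).mono_left nhdsWithin_le_nhds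
    refine le_of_tendsto hlim ?_
    filter_upwards [Ioc_mem_nhdsGT one_pos] with t ht
    exact (hnU _ (hsegment t ht.1 ht.2)).le
  obtain rfl : s = 0 := le_antisymm hs0 hs
  have hn0 : 0 < ‖n‖ := by
    refine norm_pos_iff.2 fun h => ?_
    simpa [h] using hnU v (by simpa using hsegment 1 one_pos le_rfl)
  have hball : ∀ w : Y, ‖w‖ ≤ ‖v‖ / 2 → v + w ∈ U := by
    intro w hw
    simp only [U, mem_ofPred_eq]
    have h1 := norm_add_le v w
    rw [show v - (v + w) = -w by abel, norm_neg]
    linarith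
  have hnorm : ‖n‖ ≤ -n v / (‖v‖ / 2) := by
    refine ContinuousLinearMap.opNorm_le_of_unit_norm ?_ fun x hx => ?_
    · have h1 := hnU v (by simpa using hsegment 1 one_pos le_rfl)
      exact div_nonneg (by linarith) (by positivity)
    · have hx' : ‖(‖v‖ / 2) • x‖ ≤ ‖v‖ / 2 := by
        rw [norm_smul, hx, mul_one, Real.norm_of_nonneg (by positivity)]
      have h1 := hnU _ (hball _ hx')
      have h2 := hnU _ (hball (-((‖v‖ / 2) • x)) (by rwa [norm_neg]))
      rw [map_add, map_smul, smul_eq_mul] at h1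
      rw [map_add, map_neg, map_smul, smul_eq_mul] at h2
      rw [Real.norm_eq_abs, le_div_iff₀ (by positivity), show |n x| * (‖v‖ / 2) = |‖v‖ / 2 * n x| by
        rw [abs_mul, abs_of_pos (half_pos hv0), mul_comm], abs_le]
      constructor <;> linarith
  refine ⟨-(‖n‖⁻¹ • n), fun z hz => ?_, by simp [norm_smul, hn0.ne'], ?_⟩
  · have := hnK (z - c) (by simpa [K] using hz)
    have h2 := mul_nonneg (inv_nonneg.2 hn0.le) this
    simpa using h2
  · rw [le_div_iff₀ (by positivity)] at hnorm
    simp only [_root_.neg_apply, _root_.smul_apply, smul_eq_mul]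
    rw [← mul_neg, ← mul_assoc, mul_comm 2, mul_assoc, inv_mul_eq_div, le_div_iff₀ hn0]
    linarith

/-- If the normals to the intersection decompose boundedly at all its points near `y₀`, then a
linear error bound holds near `y₀`. -/
theorem errorBound_of_boundedDecomposition [CompleteSpace Y] {ι : Type*} [Fintype ι]
    {C : ι → Set Y} (hclosed : ∀ i, IsClosed (C i)) (hconv : ∀ i, Convex ℝ (C i)) {y₀ : Y}
    (hy₀ : y₀ ∈ ⋂ i, C i) {τ δ : ℝ} (hτ : 0 ≤ τ)
    (hdec : ∀ y ∈ (⋂ i, C i) ∩ ball y₀ δ, BoundedDecomposition τ (convexNormalCone (⋂ i, C i) y)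
      (fun i => convexNormalCone (C i) y)) {y : Y} (hy : y ∈ ball y₀ (δ / 2)) :
    infDist y (⋂ i, C i) ≤ 2 * τ * ∑ i, infDist y (C i) := by
  by_cases hyC : y ∈ ⋂ i, C i
  · rw [infDist_zero_of_mem hyC]
    have : 0 ≤ ∑ i, infDist y (C i) := Finset.sum_nonneg fun i _ => infDist_nonneg
    positivity
  obtain ⟨c, hc, hca, ψ, hψ, hψ1, hψc⟩ := exists_normal_at_approximate_projection
    (isClosed_iInter hclosed) (convex_iInter hconv) hy₀ hyC
  rw [mem_ball, dist_eq_norm] at hy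
  have hcδ : c ∈ ball y₀ δ := by
    rw [mem_ball, dist_eq_norm]
    have := norm_sub_le_norm_sub_add_norm_sub c y y₀
    rw [norm_sub_rev c y] at this
    linarith
  obtain ⟨g, hg, hgs⟩ := hdec c ⟨hc, hcδ⟩ ψ hψ
  have hgi : ∀ i, g i (y - c) ≤ τ * infDist y (C i) := fun i => by
    have h1 := apply_sub_le_norm_mul_infDist (hg i).1 ⟨c, mem_iInter.1 hc i⟩ y
    have h2 : ‖g i‖ ≤ τ := by simpa [hψ1] using (hg i).2
    exact h1.trans (mul_le_mul_of_nonneg_right h2 infDist_nonneg)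
  calc infDist y (⋂ i, C i) ≤ dist y c := infDist_le_dist_of_mem hc
    _ ≤ 2 * ψ (y - c) := by rwa [dist_eq_norm]
    _ = 2 * ∑ i, g i (y - c) := by rw [← hgs, _root_.sum_apply]
    _ ≤ 2 * ∑ i, τ * infDist y (C i) := by gcongr with i; exact hgi i
    _ = _ := by rw [← Finset.mul_sum]; ring

end ConvexSets

/-! ### Uniform regularity near a point with surjective derivative -/

section Regularity

variable {X Y : Type*} [NormedAddCommGroup X] [NormedSpace ℝ X]
  [NormedAddCommGroup Y] [NormedSpace ℝ Y]

/-- Quantitative Lyusternik–Graves regularity of `f` on the ball `ball a ρ`: preimages under `f` and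
under its derivatives exist with linear rate `κ`, and `L` bounds the Lipschitz constant of `f` and
the norms of its derivatives. -/
structure RegularNear (f : X → Y) (a : X) (κ L ρ : ℝ) : Prop where
  rate_pos : 0 < κ
  lip_pos : 0 < L
  radius_pos : 0 < ρ
  lift_deriv : ∀ x ∈ ball a ρ, ∀ d, ∃ h, fderiv ℝ f x h = d ∧ ‖h‖ ≤ κ * ‖d‖
  norm_deriv_le : ∀ x ∈ ball a ρ, ‖fderiv ℝ f x‖ ≤ L
  lipschitz : ∀ x ∈ ball a ρ, ∀ x' ∈ ball a ρ, ‖f x' - f x‖ ≤ L * ‖x' - x‖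
  lift : ∀ x ∈ ball a ρ, ∀ y, ‖y - f x‖ < ρ → ∃ x', f x' = y ∧ ‖x' - x‖ ≤ κ * ‖y - f x‖

theorem exists_regularNear [CompleteSpace X] [CompleteSpace Y] {f : X → Y} (hf : ContDiff ℝ 1 f)
    {a : X} (hsurj : Function.Surjective (fderiv ℝ f a)) :
    ∃ κ L ρ, RegularNear f a κ L ρ := by
  obtain ⟨fsymm, hN⟩ := (fderiv ℝ f a).exists_nonlinearRightInverse_of_surjective
    (LinearMap.range_eq_top.2 hsurj)
  set N := fsymm.nnnorm with hNdef
  have hNR : (0 : ℝ) < N := hN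
  -- Perturbing by half of `N⁻¹` only doubles the rate `N` of the right inverse at `a`.
  set c : NNReal := N⁻¹ / 2 with hc
  have hcpos : 0 < c := by positivity
  have hcR : (0 : ℝ) < c := hcpos
  have hrate : ((N : ℝ)⁻¹ - c) * (2 * N) = 1 := by
    rw [hc]; push_cast; field_simp; norm_num
  have hstrict : HasStrictFDerivAt f (fderiv ℝ f a) a :=
    hf.contDiffAt.hasStrictFDerivAt one_ne_zero
  obtain ⟨s, hs, happ⟩ := hstrict.approximates_deriv_on_nhds (Or.inr hcpos)
  have hderiv : ∀ᶠ x in 𝓝 a, dist (fderiv ℝ f x) (fderiv ℝ f a) < c :=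
    (hf.continuous_fderiv one_ne_zero).continuousAt.eventually (ball_mem_nhds _ hcR)
  obtain ⟨r, hr, hball⟩ := Metric.mem_nhds_iff.1 (inter_mem hs hderiv)
  have happr : ApproximatesLinearOn f (fderiv ℝ f a) (ball a r) c :=
    happ.mono_set fun x hx => (hball hx).1
  have hκ : 0 < 1 + 2 * (N : ℝ) := by positivity
  have hsub : ball a (r / (1 + 2 * N)) ⊆ ball a r :=
    ball_subset_ball (div_le_self hr.le (by linarith))
  refine ⟨2 * N, ‖fderiv ℝ f a‖ + c, r / (1 + 2 * N), by positivity, by positivity,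
    by positivity, ?_, ?_, ?_, ?_⟩
  · intro x hx d
    have hx' : ‖fderiv ℝ f x - fderiv ℝ f a‖ ≤ c := by
      rw [← dist_eq_norm]; exact (hball (hsub hx)).2.le
    have hlin : ApproximatesLinearOn (fderiv ℝ f x) (fderiv ℝ f a) univ c := by
      intro u _ v _
      rw [← map_sub, ← _root_.sub_apply]
      exact ContinuousLinearMap.le_of_opNorm_le _ hx' _
    obtain ⟨h, hh, rfl⟩ := hlin.surjOn_closedBall_of_nonlinearRightInverse fsymm
      (b := 0) (ε := 2 * N * ‖d‖) (by positivity) (subset_univ _)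
      (show d ∈ _ by
        rw [← hNdef, ← mul_assoc, hrate]
        simp)
    exact ⟨h, rfl, by simpa using hh⟩
  · intro x hx
    have h1 : ‖fderiv ℝ f x - fderiv ℝ f a‖ < c := by
      rw [← dist_eq_norm]; exact (hball (hsub hx)).2
    linarith [norm_le_norm_add_norm_sub' (fderiv ℝ f x) (fderiv ℝ f a)]
  · intro x hx x' hx'
    have h1 := happr x' (hsub hx') x (hsub hx)
    have h2 := (fderiv ℝ f a).le_opNorm (x' - x)
    linarith [norm_le_norm_add_norm_sub' (f x' - f x) (fderiv ℝ f a (x' - x))]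
  · intro x hx y hy
    obtain ⟨x', hx', rfl⟩ := happr.surjOn_closedBall_of_nonlinearRightInverse fsymm
      (b := x) (ε := 2 * N * ‖y - f x‖) (by positivity)
      (by
        refine closedBall_subset_ball' ?_
        rw [mem_ball] at hx
        have h1 : 2 * N * ‖y - f x‖ ≤ 2 * N * (r / (1 + 2 * N)) := by gcongr
        have h2 : r / (1 + 2 * N) + 2 * N * (r / (1 + 2 * N)) = r := by field_simp
        linarith)
      (show y ∈ _ by
        rw [← hNdef, ← mul_assoc, hrate, mem_closedBall, dist_eq_norm]
        simp)
    exact ⟨x', rfl, by rwa [mem_closedBall, dist_eq_norm] at hx'⟩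

namespace RegularNear

variable {f : X → Y} {a : X} {κ L ρ : ℝ}

/-- Metric regularity: distances to preimages are controlled by distances to the sets. -/
theorem infDist_preimage_le (h : RegularNear f a κ L ρ) {S : Set Y} (hS : f a ∈ S) {x : X}
    (hx : x ∈ ball a (min ρ (κ * ρ))) : infDist x (f ⁻¹' S) ≤ κ * infDist (f x) S := by
  have hκ := h.rate_pos
  rw [mul_comm, ← div_le_iff₀ hκ]
  refine (le_infDist ⟨_, hS⟩).2 fun y hy => ?_
  rw [div_le_iff₀ hκ, mul_comm, dist_comm, dist_eq_norm]
  rw [mem_ball, lt_min_iff] at hx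
  rcases lt_or_ge ‖y - f x‖ ρ with hlt | hge
  · obtain ⟨x', rfl, hx'⟩ := h.lift x hx.1 y hlt
    rw [← dist_eq_norm, dist_comm] at hx'
    exact (infDist_le_dist_of_mem (show x' ∈ f ⁻¹' S from hy)).trans hx'
  · exact (infDist_le_dist_of_mem (show a ∈ f ⁻¹' S from hS)).trans
      (hx.2.le.trans (mul_le_mul_of_nonneg_left hge hκ.le))

theorem infDist_le_infDist_preimage (h : RegularNear f a κ L ρ) {S : Set Y} (hS : f a ∈ S) {x : X}
    (hx : x ∈ ball a (ρ / 2)) : infDist (f x) S ≤ L * infDist x (f ⁻¹' S) := by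
  have hL := h.lip_pos
  have hxρ : x ∈ ball a ρ := ball_subset_ball (by linarith [h.radius_pos]) hx
  have hlip : ∀ z ∈ ball a ρ, f z ∈ S → infDist (f x) S ≤ L * dist x z := fun z hz hzS => by
    rw [dist_eq_norm]
    refine (infDist_le_dist_of_mem hzS).trans ?_
    rw [dist_eq_norm]
    exact h.lipschitz z hz x hxρ
  rw [mul_comm, ← div_le_iff₀ hL]
  refine (le_infDist ⟨a, hS⟩).2 fun z hz => ?_
  rw [div_le_iff₀ hL, mul_comm]
  by_cases hzρ : z ∈ ball a ρ
  · exact hlip z hzρ hz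
  · refine (hlip a (mem_ball_self h.radius_pos) hS).trans (mul_le_mul_of_nonneg_left ?_ hL.le)
    -- A point of the preimage outside the ball is farther from `x` than `a` is.
    rw [mem_ball, not_lt] at hzρ
    rw [mem_ball] at hx
    linarith [dist_triangle z x a, dist_comm z x]

/-- Subtransversality of preimages is a linear error bound for the sets themselves. -/
theorem subtransversalAt_iff (h : RegularNear f a κ L ρ) {m : ℕ} {C : Fin m → Set Y}
    (ha : f a ∈ ⋂ i, C i) :
    SubtransversalAt (fun i => f ⁻¹' C i) a ↔
      ∃ τ > (0 : ℝ), ∃ r > (0 : ℝ), ∀ y ∈ ball (f a) r,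
        infDist y (⋂ i, C i) ≤ τ * ∑ i, infDist y (C i) := by
  have hκ := h.rate_pos
  have hL := h.lip_pos
  have hρ := h.radius_pos
  have hai : ∀ i, f a ∈ C i := mem_iInter.1 ha
  constructor
  · rintro ⟨τ, hτ, r, hr, hsub⟩
    have hR : 0 < min r (min (ρ / 2) (κ * ρ)) := by positivity
    refine ⟨L * τ * κ, by positivity, min ρ (min r (min (ρ / 2) (κ * ρ)) / κ), by positivity,
      fun y hy => ?_⟩
    rw [mem_ball, lt_min_iff, dist_eq_norm] at hy
    obtain ⟨x, rfl, hx⟩ := h.lift a (mem_ball_self hρ) y hy.1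
    have hxR : dist x a < min r (min (ρ / 2) (κ * ρ)) := by
      rw [dist_eq_norm]
      refine hx.trans_lt ?_
      rw [mul_comm]
      exact (lt_div_iff₀ hκ).1 hy.2
    rw [lt_min_iff, lt_min_iff] at hxR
    have h1 := hsub x hxR.1
    rw [← preimage_iInter] at h1
    calc infDist (f x) (⋂ i, C i) ≤ L * infDist x (f ⁻¹' ⋂ i, C i) :=
          h.infDist_le_infDist_preimage ha hxR.2.1
      _ ≤ L * (τ * ∑ i, infDist x (f ⁻¹' C i)) := by gcongr
      _ ≤ L * (τ * ∑ i, κ * infDist (f x) (C i)) := by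
          gcongr with i
          exact h.infDist_preimage_le (hai i)
            (lt_min (hxR.2.1.trans (by linarith)) hxR.2.2)
      _ = L * τ * κ * ∑ i, infDist (f x) (C i) := by rw [← Finset.mul_sum]; ring
  · rintro ⟨τ, hτ, r, hr, herr⟩
    refine ⟨κ * τ * L, by positivity, min (min (ρ / 2) (κ * ρ)) (r / L), by positivity,
      fun x hx => ?_⟩
    rw [mem_ball, lt_min_iff, lt_min_iff] at hx
    have hxρ : dist x a < ρ := hx.1.1.trans (by linarith)
    have hfx : f x ∈ ball (f a) r := by
      rw [mem_ball, dist_eq_norm]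
      refine (h.lipschitz a (mem_ball_self hρ) x hxρ).trans_lt ?_
      rw [← dist_eq_norm, mul_comm]
      exact (lt_div_iff₀ hL).1 hx.2
    rw [← preimage_iInter]
    calc infDist x (f ⁻¹' ⋂ i, C i) ≤ κ * infDist (f x) (⋂ i, C i) :=
          h.infDist_preimage_le ha (lt_min hxρ hx.1.2)
      _ ≤ κ * (τ * ∑ i, infDist (f x) (C i)) := by gcongr; exact herr _ hfx
      _ ≤ κ * (τ * ∑ i, L * infDist x (f ⁻¹' C i)) := by
          gcongr with i
          exact h.infDist_le_infDist_preimage (hai i) hx.1.1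
      _ = κ * τ * L * ∑ i, infDist x (f ⁻¹' C i) := by rw [← Finset.mul_sum]; ring

end RegularNear

/-! ### Normal cones to preimages of convex sets -/

theorem mem_epsNormals_iff {ε : ℝ} {A : Set X} {x : X} {φ : StrongDual ℝ X} :
    φ ∈ epsNormals ε A x ↔ ∀ η > 0, ∀ᶠ y in 𝓝[A] x, φ (y - x) ≤ (ε + η) * ‖y - x‖ := by
  have hdiv : ∀ {y : X} {K : ℝ}, y ≠ x → (φ (y - x) / ‖y - x‖ ≤ K ↔ φ (y - x) ≤ K * ‖y - x‖) :=
    fun hy => div_le_iff₀ (norm_pos_iff.2 (sub_ne_zero.2 hy))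
  unfold epsNormals
  rw [mem_ofPred_eq, limsup_le_iff']
  constructor
  · intro h η hη
    have h1 := h ((ε + η : ℝ) : EReal) (EReal.coe_lt_coe_iff.2 (by linarith))
    rw [eventually_nhdsWithin_iff] at h1 ⊢
    filter_upwards [h1] with y hy hyA
    rcases eq_or_ne y x with rfl | hne
    · simp
    · exact (hdiv hne).1 (EReal.coe_le_coe_iff.1 (hy ⟨hyA, hne⟩))
  · intro h z hz
    obtain ⟨r, hr1, hr2⟩ := EReal.lt_iff_exists_real_btwn.1 hz
    have h1 := h (r - ε) (sub_pos.2 (EReal.coe_lt_coe_iff.1 hr1))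
    rw [eventually_nhdsWithin_iff] at h1 ⊢
    filter_upwards [h1] with y hy hyA
    refine le_trans (EReal.coe_le_coe_iff.2 ((hdiv hyA.2).2 ?_)) hr2.le
    simpa using hy hyA.1

theorem frechetNormalCone_subset_limitingNormalCone {A : Set X} {x : X} (hx : x ∈ A) :
    frechetNormalCone A x ⊆ limitingNormalCone A x := fun φ hφ =>
  ⟨fun _ => x, fun _ => 0, fun _ => φ, fun _ => hx, fun _ => le_rfl, fun _ => hφ,
    tendsto_const_nhds, tendsto_const_nhds, tendsto_const_nhds⟩

namespace RegularNear

variable {f : X → Y} {a : X} {κ L ρ : ℝ}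

/-- An `ε`-normal to the preimage of a convex set is almost nonpositive on the directions that the
derivative maps into that set: such directions are tangent to the preimage, by openness of `f`. -/
theorem apply_le_of_mem_epsNormals (h : RegularNear f a κ L ρ) {S : Set Y} (hS : Convex ℝ S) {u : X}
    (hu : u ∈ ball a ρ) (hd : DifferentiableAt ℝ f u) (huS : f u ∈ S) {ε : ℝ} {φ : StrongDual ℝ X}
    (hφ : φ ∈ epsNormals ε (f ⁻¹' S) u) {w : X} (hw : f u + fderiv ℝ f u w ∈ S) :
    φ w ≤ ε * ‖w‖ := by
  have hcurve : Tendsto (fun t : ℝ => u + t • w) (𝓝[>] 0) (𝓝 u) := by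
    have : Continuous fun t : ℝ => u + t • w := by fun_prop
    simpa using (this.tendsto 0).mono_left nhdsWithin_le_nhds
  let gap : ℝ → Y := fun t => (f u + t • fderiv ℝ f u w) - f (u + t • w)
  have hgap : Tendsto (fun t : ℝ => t⁻¹ * ‖gap t‖) (𝓝[>] 0) (𝓝 0) := by
    have h1 := (hd.hasFDerivAt.hasLineDerivAt w).tendsto_slope_zero_right
    have h2 := (tendsto_const_nhds (x := fderiv ℝ f u w)).sub h1
    rw [sub_self] at h2
    refine (tendsto_zero_iff_norm_tendsto_zero.1 h2).congr' ?_
    filter_upwards [self_mem_nhdsWithin] with t ht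
    have ht : 0 < t := ht
    have : fderiv ℝ f u w - t⁻¹ • (f (u + t • w) - f u) = t⁻¹ • gap t := by
      simp only [gap, smul_sub, smul_add, smul_smul, inv_mul_cancel₀ ht.ne', one_smul]
      abel
    rw [this, norm_smul, norm_inv, Real.norm_of_nonneg ht.le]
  have hgap0 : Tendsto (fun t : ℝ => ‖gap t‖) (𝓝[>] 0) (𝓝 0) := by
    have h1 : Tendsto (fun t : ℝ => t) (𝓝[>] 0) (𝓝 0) := nhdsWithin_le_nhds
    have h2 := h1.mul hgap
    rw [mul_zero] at h2
    refine h2.congr' ?_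
    filter_upwards [self_mem_nhdsWithin] with t ht
    exact mul_inv_cancel_left₀ (ne_of_gt ht) _
  have hex : ∀ᶠ t in 𝓝[>] (0 : ℝ), ∃ x', f x' = f u + t • fderiv ℝ f u w ∧
      ‖x' - (u + t • w)‖ ≤ κ * ‖gap t‖ := by
    filter_upwards [hcurve.eventually (isOpen_ball.mem_nhds hu),
      hgap0.eventually (gt_mem_nhds h.radius_pos)] with t ht1 ht2
    exact h.lift _ ht1 _ ht2
  obtain ⟨x', hx'⟩ := hex.choice
  have hquot : Tendsto (fun t : ℝ => t⁻¹ • (x' t - u)) (𝓝[>] 0) (𝓝 w) := by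
    rw [tendsto_iff_norm_sub_tendsto_zero]
    have h1 : Tendsto (fun t : ℝ => κ * (t⁻¹ * ‖gap t‖)) (𝓝[>] 0) (𝓝 0) := by
      simpa using hgap.const_mul κ
    refine squeeze_zero' (Eventually.of_forall fun _ => norm_nonneg _) ?_ h1
    filter_upwards [hx', self_mem_nhdsWithin] with t ht ht0
    have ht0 : 0 < t := ht0
    have : t⁻¹ • (x' t - u) - w = t⁻¹ • (x' t - (u + t • w)) := by
      simp only [smul_sub, smul_add, smul_smul, inv_mul_cancel₀ ht0.ne', one_smul]
      abel
    rw [this, norm_smul, norm_inv, Real.norm_of_nonneg ht0.le, mul_left_comm]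
    exact mul_le_mul_of_nonneg_left ht.2 (inv_nonneg.2 ht0.le)
  have hx'u : Tendsto x' (𝓝[>] 0) (𝓝 u) := by
    have h1 : Tendsto (fun t : ℝ => t) (𝓝[>] 0) (𝓝 0) := nhdsWithin_le_nhds
    have h2 := (h1.smul hquot).const_add u
    rw [zero_smul, add_zero] at h2
    refine h2.congr' ?_
    filter_upwards [self_mem_nhdsWithin] with t ht
    rw [smul_smul, mul_inv_cancel₀ (ne_of_gt ht), one_smul, add_sub_cancel]
  have hx'S : ∀ᶠ t in 𝓝[>] (0 : ℝ), x' t ∈ f ⁻¹' S := by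
    filter_upwards [hx', Ioc_mem_nhdsGT one_pos] with t ht ht1
    have := hS.add_smul_sub_mem huS hw ⟨ht1.1.le, ht1.2⟩
    rwa [add_sub_cancel_left, ← ht.1] at this
  have hη : ∀ η > 0, φ w ≤ (ε + η) * ‖w‖ := by
    intro η hη
    have h1 := (tendsto_nhdsWithin_iff.2 ⟨hx'u, hx'S⟩).eventually (mem_epsNormals_iff.1 hφ η hη)
    refine le_of_tendsto_of_tendsto ((φ.continuous.tendsto w).comp hquot)
      (hquot.norm.const_mul (ε + η)) ?_
    filter_upwards [h1, self_mem_nhdsWithin] with t ht ht0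
    have ht0 : 0 < t := ht0
    simp only [Function.comp_apply, map_smul, smul_eq_mul, norm_smul, norm_inv,
      Real.norm_of_nonneg ht0.le]
    rw [mul_left_comm]
    exact mul_le_mul_of_nonneg_left ht (inv_nonneg.2 ht0.le)
  have hlim : Tendsto (fun η : ℝ => (ε + η) * ‖w‖) (𝓝[>] 0) (𝓝 (ε * ‖w‖)) := by
    have : Continuous fun η : ℝ => (ε + η) * ‖w‖ := by fun_prop
    simpa using (this.tendsto 0).mono_left nhdsWithin_le_nhds
  exact ge_of_tendsto hlim (by filter_upwards [self_mem_nhdsWithin] with η h using hη η h)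

/-- A functional that is nonpositive on the directions mapped by the derivative into `S` vanishes
on the kernel of the derivative, hence factors through it. -/
theorem exists_comp_fderiv_eq (h : RegularNear f a κ L ρ) {S : Set Y} {x : X} (hx : x ∈ ball a ρ)
    (hxS : f x ∈ S) {φ : StrongDual ℝ X}
    (hφ : ∀ w, f x + fderiv ℝ f x w ∈ S → φ w ≤ 0) :
    ∃ ψ ∈ convexNormalCone S (f x), ψ.comp (fderiv ℝ f x) = φ := by
  have hker : ∀ w, fderiv ℝ f x w = 0 → φ w = 0 := fun w hw => by
    have h1 := hφ w (by simpa [hw] using hxS)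
    have h2 := hφ (-w) (by simpa [hw] using hxS)
    rw [map_neg] at h2
    linarith
  choose lift hlift hnorm using h.lift_deriv x hx
  have hfact : ∀ w, φ (lift (fderiv ℝ f x w)) = φ w := fun w => by
    have := hker (lift (fderiv ℝ f x w) - w) (by rw [map_sub, hlift, sub_self])
    rwa [map_sub, sub_eq_zero] at this
  let ψ : Y →ₗ[ℝ] ℝ :=
    { toFun := fun d => φ (lift d)
      map_add' := fun d e => by
        rw [← map_add, ← hfact (lift d + lift e), map_add (fderiv ℝ f x), hlift, hlift]
      map_smul' := fun c d => by
        simp only [RingHom.id_apply]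
        rw [← map_smul, ← hfact (c • lift d), map_smul (fderiv ℝ f x), hlift] }
  refine ⟨ψ.mkContinuous (‖φ‖ * κ) fun d => ?_, fun c hc => ?_, ?_⟩
  · rw [mul_assoc]
    exact (φ.le_opNorm _).trans (mul_le_mul_of_nonneg_left (hnorm d) (norm_nonneg _))
  · exact hφ _ (by rw [hlift]; simpa using hc)
  · ext w
    exact hfact w

theorem norm_le_norm_comp_fderiv (h : RegularNear f a κ L ρ) {x : X} (hx : x ∈ ball a ρ)
    (ψ : StrongDual ℝ Y) : ‖ψ‖ ≤ κ * ‖ψ.comp (fderiv ℝ f x)‖ := by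
  have hκ := h.rate_pos
  refine ψ.opNorm_le_bound (by positivity) fun d => ?_
  obtain ⟨w, rfl, hw⟩ := h.lift_deriv x hx d
  have h1 := (ψ.comp (fderiv ℝ f x)).le_opNorm w
  have h2 := mul_le_mul_of_nonneg_left hw (norm_nonneg (ψ.comp (fderiv ℝ f x)))
  calc ‖ψ (fderiv ℝ f x w)‖ ≤ _ := h1
    _ ≤ _ := h2
    _ = _ := by ring

theorem norm_comp_fderiv_le (h : RegularNear f a κ L ρ) {x : X} (hx : x ∈ ball a ρ)
    (ψ : StrongDual ℝ Y) : ‖ψ.comp (fderiv ℝ f x)‖ ≤ L * ‖ψ‖ := by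
  rw [mul_comm]
  exact (ψ.opNorm_comp_le _).trans (mul_le_mul_of_nonneg_left (h.norm_deriv_le x hx) (norm_nonneg _))

theorem comp_fderiv_injective (h : RegularNear f a κ L ρ) {x : X} (hx : x ∈ ball a ρ) :
    Function.Injective fun ψ : StrongDual ℝ Y => ψ.comp (fderiv ℝ f x) := by
  intro ψ ψ' he
  ext d
  obtain ⟨w, rfl, -⟩ := h.lift_deriv x hx d
  exact DFunLike.congr_fun he w

/-- Passing to the limit along `ε`-normals is possible because weak-star convergent sequences are
bounded and the derivatives near `a` can be solved with a uniform rate. -/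
theorem limitingNormalCone_subset [CompleteSpace X] (h : RegularNear f a κ L ρ)
    (hf : ContDiff ℝ 1 f) {S : Set Y} (hS : Convex ℝ S) {x : X} (hx : x ∈ ball a ρ)
    (hxS : f x ∈ S) :
    limitingNormalCone (f ⁻¹' S) x ⊆
      (fun ψ : StrongDual ℝ Y => ψ.comp (fderiv ℝ f x)) '' convexNormalCone S (f x) := by
  rintro φ ⟨u, ε, ψ, huS, -, hψ, hu, hε, hlim⟩
  have hpt : ∀ w, Tendsto (fun n => ψ n w) atTop (𝓝 (φ w)) := fun w =>
    tendsto_iff_forall_eval_tendsto_topDualPairing.1 hlim w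
  obtain ⟨M, hM⟩ : ∃ M, ∀ n, ‖ψ n‖ ≤ M :=
    banach_steinhaus fun w => by
      obtain ⟨K, hK⟩ := (hpt w).norm.bddAbove_range
      exact ⟨K, fun n => hK (mem_range_self n)⟩
  refine h.exists_comp_fderiv_eq hx hxS fun w hw => ?_
  have huρ : ∀ᶠ n in atTop, u n ∈ ball a ρ := hu.eventually (isOpen_ball.mem_nhds hx)
  -- Correct `w` to directions at `u n` whose images still point to the same element of `S`.
  let d : ℕ → Y := fun n => (f x + fderiv ℝ f x w) - (f (u n) + fderiv ℝ f (u n) w)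
  have hd : Tendsto (fun n => κ * ‖d n‖) atTop (𝓝 0) := by
    have h1 : Tendsto (fun n => f (u n)) atTop (𝓝 (f x)) := (hf.continuous.tendsto x).comp hu
    have h2 : Tendsto (fun n => fderiv ℝ f (u n) w) atTop (𝓝 (fderiv ℝ f x w)) :=
      (((hf.continuous_fderiv one_ne_zero).clm_apply continuous_const).tendsto x).comp hu
    have h3 := ((tendsto_const_nhds (x := f x + fderiv ℝ f x w)).sub (h1.add h2)).norm.const_mul κ
    simpa using h3
  have hex : ∀ᶠ n in atTop, ∃ v, fderiv ℝ f (u n) v = d n ∧ ‖v‖ ≤ κ * ‖d n‖ := by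
    filter_upwards [huρ] with n hn using h.lift_deriv _ hn _
  obtain ⟨v, hv⟩ := hex.choice
  have hv0 : Tendsto v atTop (𝓝 0) :=
    squeeze_zero_norm' (hv.mono fun n hn => hn.2) hd
  have hψv : Tendsto (fun n => ψ n (v n)) atTop (𝓝 0) := by
    refine squeeze_zero_norm (a := fun n => M * ‖v n‖)
      (fun n => (ψ n).le_of_opNorm_le (hM n) _) ?_
    simpa using hv0.norm.const_mul M
  have hleft : Tendsto (fun n => ψ n (w + v n)) atTop (𝓝 (φ w)) := by
    simpa using (hpt w).add hψv
  have hright : Tendsto (fun n => ε n * ‖w + v n‖) atTop (𝓝 0) := by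
    simpa using hε.mul (hv0.const_add w).norm
  refine le_of_tendsto_of_tendsto hleft hright ?_
  filter_upwards [huρ, hv] with n hn hvn
  refine h.apply_le_of_mem_epsNormals hS hn (hf.differentiable one_ne_zero _) (huS n) (hψ n) ?_
  rw [map_add, hvn.1, ← add_assoc, add_sub_cancel]
  exact hw

theorem comp_fderiv_mem_frechetNormalCone {S : Set Y} {x : X} (hd : DifferentiableAt ℝ f x)
    {ψ : StrongDual ℝ Y} (hψ : ψ ∈ convexNormalCone S (f x)) :
    ψ.comp (fderiv ℝ f x) ∈ frechetNormalCone (f ⁻¹' S) x := by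
  refine mem_epsNormals_iff.2 fun η hη => ?_
  have hη' : 0 < η / (‖ψ‖ + 1) := by positivity
  have h1 := nhdsWithin_le_nhds (s := f ⁻¹' S) (hd.hasFDerivAt.isLittleO.def hη')
  filter_upwards [h1, self_mem_nhdsWithin] with y hy hyS
  have h2 : ψ (f y - f x) ≤ 0 := hψ _ hyS
  have h3 : ‖ψ (f y - f x - fderiv ℝ f x (y - x))‖ ≤ ‖ψ‖ * (η / (‖ψ‖ + 1) * ‖y - x‖) :=
    (ψ.le_opNorm _).trans (mul_le_mul_of_nonneg_left hy (norm_nonneg _))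
  have h4 : ‖ψ‖ * (η / (‖ψ‖ + 1) * ‖y - x‖) ≤ η * ‖y - x‖ := by
    rw [← mul_assoc]
    refine mul_le_mul_of_nonneg_right ?_ (norm_nonneg _)
    rw [mul_div_assoc', div_le_iff₀ (by positivity)]
    nlinarith [norm_nonneg ψ]
  have h5 := (abs_le.1 (h3.trans h4)).1
  rw [map_sub] at h5
  simp only [ContinuousLinearMap.comp_apply, zero_add]
  linarith

/-- Near `a`, both normal cones to the preimage of a convex set are the image of the convex normal
cone under the adjoint of the derivative. -/
theorem frechetNormalCone_preimage [CompleteSpace X] (h : RegularNear f a κ L ρ)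
    (hf : ContDiff ℝ 1 f) {S : Set Y} (hS : Convex ℝ S) {x : X} (hx : x ∈ ball a ρ)
    (hxS : f x ∈ S) :
    frechetNormalCone (f ⁻¹' S) x =
      (fun ψ : StrongDual ℝ Y => ψ.comp (fderiv ℝ f x)) '' convexNormalCone S (f x) :=
  Subset.antisymm
    ((frechetNormalCone_subset_limitingNormalCone (A := f ⁻¹' S) hxS).trans
      (h.limitingNormalCone_subset hf hS hx hxS))
    (image_subset_iff.2 fun _ hψ =>
      comp_fderiv_mem_frechetNormalCone (hf.differentiable one_ne_zero x) hψ)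

theorem limitingNormalCone_preimage [CompleteSpace X] (h : RegularNear f a κ L ρ)
    (hf : ContDiff ℝ 1 f) {S : Set Y} (hS : Convex ℝ S) {x : X} (hx : x ∈ ball a ρ)
    (hxS : f x ∈ S) : limitingNormalCone (f ⁻¹' S) x = frechetNormalCone (f ⁻¹' S) x :=
  Subset.antisymm
    ((h.limitingNormalCone_subset hf hS hx hxS).trans
      (h.frechetNormalCone_preimage hf hS hx hxS).superset)
    (frechetNormalCone_subset_limitingNormalCone (A := f ⁻¹' S) hxS)

/-- Strong Fréchet CHIP together with property (G) for preimages of convex sets, expressed by the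
convex normal cones of those sets. -/
theorem strongFrechetCHIPAt_and_propertyG_iff [CompleteSpace X] (h : RegularNear f a κ L ρ)
    (hf : ContDiff ℝ 1 f) {m : ℕ} {C : Fin m → Set Y} (hC : ∀ i, Convex ℝ (C i)) {x : X}
    (hx : x ∈ ball a ρ) (hxC : f x ∈ ⋂ i, C i) {τ : ℝ} (hτ : 0 < τ) :
    (StrongFrechetCHIPAt (fun i => f ⁻¹' C i) x ∧
        PropertyGWith τ (fun i => frechetNormalCone (f ⁻¹' C i) x)) ↔
      BoundedDecomposition τ
        ((fun ψ : StrongDual ℝ Y => ψ.comp (fderiv ℝ f x)) '' convexNormalCone (⋂ i, C i) (f x))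
        (fun i => (fun ψ : StrongDual ℝ Y => ψ.comp (fderiv ℝ f x)) ''
          convexNormalCone (C i) (f x)) := by
  unfold StrongFrechetCHIPAt
  rw [← preimage_iInter, h.frechetNormalCone_preimage hf (convex_iInter hC) hx hxC]
  simp only [h.frechetNormalCone_preimage hf (hC _) hx (mem_iInter.1 hxC _)]
  refine subset_sum_and_propertyG_iff hτ
    (fun i => ⟨0, zero_mem_convexNormalCone _ _, ContinuousLinearMap.zero_comp _⟩) ?_ ?_
  · rintro i _ ⟨ψ, hψ, rfl⟩ t ht
    exact ⟨t • ψ, smul_mem_convexNormalCone hψ ht, ContinuousLinearMap.smul_comp _ _ _⟩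
  · intro φ hφ
    obtain ⟨g, hg, rfl⟩ := (Set.mem_fintype_sum _ _).1 hφ
    choose ψ hψ hψg using hg
    refine ⟨∑ i, ψ i, fun c hc => ?_, ?_⟩
    · rw [_root_.sum_apply]
      exact Finset.sum_nonpos fun i _ => hψ i c (mem_iInter.1 hc i)
    · ext w
      simp [← hψg]

theorem boundedDecomposition_image (h : RegularNear f a κ L ρ) {x : X} (hx : x ∈ ball a ρ)
    {ι : Type*} [Fintype ι] {P : Set (StrongDual ℝ Y)} {Q : ι → Set (StrongDual ℝ Y)} {τ : ℝ}
    (hτ : 0 ≤ τ) (hdec : BoundedDecomposition τ P Q) :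
    BoundedDecomposition (L * τ * κ) ((fun ψ : StrongDual ℝ Y => ψ.comp (fderiv ℝ f x)) '' P)
      (fun i => (fun ψ : StrongDual ℝ Y => ψ.comp (fderiv ℝ f x)) '' Q i) := by
  have hL := h.lip_pos
  rintro _ ⟨ψ, hψ, rfl⟩
  obtain ⟨g, hg, rfl⟩ := hdec ψ hψ
  refine ⟨fun i => (g i).comp (fderiv ℝ f x), fun i => ⟨⟨g i, (hg i).1, rfl⟩, ?_⟩, ?_⟩
  · calc _ ≤ L * ‖g i‖ := h.norm_comp_fderiv_le hx _
      _ ≤ L * (τ * ‖∑ i, g i‖) := by gcongr; exact (hg i).2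
      _ ≤ L * (τ * (κ * ‖(∑ i, g i).comp (fderiv ℝ f x)‖)) := by
          gcongr; exact h.norm_le_norm_comp_fderiv hx _
      _ = _ := by ring
  · ext w
    simp

theorem boundedDecomposition_of_image (h : RegularNear f a κ L ρ) {x : X} (hx : x ∈ ball a ρ)
    {ι : Type*} [Fintype ι] {P : Set (StrongDual ℝ Y)} {Q : ι → Set (StrongDual ℝ Y)} {τ : ℝ}
    (hτ : 0 ≤ τ)
    (hdec : BoundedDecomposition τ ((fun ψ : StrongDual ℝ Y => ψ.comp (fderiv ℝ f x)) '' P)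
      (fun i => (fun ψ : StrongDual ℝ Y => ψ.comp (fderiv ℝ f x)) '' Q i)) :
    BoundedDecomposition (κ * τ * L) P Q := by
  have hκ := h.rate_pos
  intro ψ hψ
  obtain ⟨φ, hφ, hφs⟩ := hdec _ ⟨ψ, hψ, rfl⟩
  choose g hgQ hg using fun i => (hφ i).1
  refine ⟨g, fun i => ⟨hgQ i, ?_⟩, h.comp_fderiv_injective hx ?_⟩
  · calc ‖g i‖ ≤ κ * ‖φ i‖ := by rw [← hg i]; exact h.norm_le_norm_comp_fderiv hx _
      _ ≤ κ * (τ * ‖ψ.comp (fderiv ℝ f x)‖) := by gcongr; exact (hφ i).2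
      _ ≤ κ * (τ * (L * ‖ψ‖)) := by gcongr; exact h.norm_comp_fderiv_le hx _
      _ = _ := by ring
  · rw [← hφs]
    ext w
    simp [← hg]

end RegularNear

end Regularity

/-! ### Characterizations of subtransversality -/

namespace RegularNear

variable {X Y : Type*} [NormedAddCommGroup X] [NormedSpace ℝ X] [CompleteSpace X]
  [NormedAddCommGroup Y] [NormedSpace ℝ Y] {f : X → Y} {a : X} {κ L ρ : ℝ} {m : ℕ}
  {C : Fin m → Set Y}

theorem strongFrechetCHIP_and_propertyG_of_subtransversalAt (h : RegularNear f a κ L ρ)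
    (hf : ContDiff ℝ 1 f) (hC : ∀ i, Convex ℝ (C i)) (ha : f a ∈ ⋂ i, C i)
    (hsub : SubtransversalAt (fun i => f ⁻¹' C i) a) :
    ∃ τ > (0 : ℝ), ∃ δ > (0 : ℝ), ∀ x ∈ (⋂ i, f ⁻¹' C i) ∩ ball a δ,
      StrongFrechetCHIPAt (fun i => f ⁻¹' C i) x ∧
        PropertyGWith τ (fun i => frechetNormalCone (f ⁻¹' C i) x) := by
  have hκ := h.rate_pos
  have hL := h.lip_pos
  have hρ := h.radius_pos
  obtain ⟨τ, hτ, r, hr, herr⟩ := (h.subtransversalAt_iff ha).1 hsub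
  refine ⟨L * τ * κ, by positivity, min ρ (r / L), by positivity, ?_⟩
  rintro x ⟨hxA, hx⟩
  rw [← preimage_iInter] at hxA
  rw [mem_ball, lt_min_iff] at hx
  refine (h.strongFrechetCHIPAt_and_propertyG_iff hf hC hx.1 hxA (by positivity)).2
    (h.boundedDecomposition_image hx.1 hτ.le
      (boundedDecomposition_of_errorBound hC hxA hτ.le ?_))
  have hfx : f x ∈ ball (f a) r := by
    rw [mem_ball, dist_eq_norm]
    refine (h.lipschitz a (mem_ball_self hρ) x hx.1).trans_lt ?_
    rw [← dist_eq_norm, mul_comm]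
    exact (lt_div_iff₀ hL).1 hx.2
  filter_upwards [isOpen_ball.mem_nhds hfx] with y hy using herr y hy

theorem subtransversalAt_of_strongFrechetCHIP_and_propertyG [CompleteSpace Y]
    (h : RegularNear f a κ L ρ) (hf : ContDiff ℝ 1 f) (hclosed : ∀ i, IsClosed (C i))
    (hC : ∀ i, Convex ℝ (C i)) (ha : f a ∈ ⋂ i, C i) {τ δ : ℝ} (hτ : 0 < τ) (hδ : 0 < δ)
    (hG : ∀ x ∈ (⋂ i, f ⁻¹' C i) ∩ ball a δ, StrongFrechetCHIPAt (fun i => f ⁻¹' C i) x ∧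
      PropertyGWith τ (fun i => frechetNormalCone (f ⁻¹' C i) x)) :
    SubtransversalAt (fun i => f ⁻¹' C i) a := by
  have hκ := h.rate_pos
  have hL := h.lip_pos
  have hρ := h.radius_pos
  set r := min ρ (min ρ δ / κ) with hr
  have hr0 : 0 < r := by positivity
  refine (h.subtransversalAt_iff ha).2 ⟨2 * (κ * τ * L), by positivity, r / 2, by positivity,
    fun y hy => errorBound_of_boundedDecomposition hclosed hC ha (by positivity) ?_ hy⟩
  rintro z ⟨hzC, hz⟩
  rw [mem_ball, hr, lt_min_iff, dist_eq_norm] at hz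
  obtain ⟨x, rfl, hx⟩ := h.lift a (mem_ball_self hρ) z hz.1
  have hxa : dist x a < min ρ δ := by
    rw [dist_eq_norm]
    refine hx.trans_lt ?_
    rw [mul_comm]
    exact (lt_div_iff₀ hκ).1 hz.2
  rw [lt_min_iff] at hxa
  refine h.boundedDecomposition_of_image hxa.1 hτ.le
    ((h.strongFrechetCHIPAt_and_propertyG_iff hf hC hxa.1 hzC hτ).1 (hG x ⟨?_, hxa.2⟩))
  rwa [← preimage_iInter]

theorem strongLimitingCHIP_and_propertyG_iff (h : RegularNear f a κ L ρ) (hf : ContDiff ℝ 1 f)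
    (hC : ∀ i, Convex ℝ (C i)) {x : X} (hx : x ∈ ball a ρ) (hxC : f x ∈ ⋂ i, C i) (τ : ℝ) :
    (StrongLimitingCHIPAt (fun i => f ⁻¹' C i) x ∧
        PropertyGWith τ (fun i => limitingNormalCone (f ⁻¹' C i) x)) ↔
      (StrongFrechetCHIPAt (fun i => f ⁻¹' C i) x ∧
        PropertyGWith τ (fun i => frechetNormalCone (f ⁻¹' C i) x)) := by
  unfold StrongLimitingCHIPAt StrongFrechetCHIPAt
  rw [← preimage_iInter, h.limitingNormalCone_preimage hf (convex_iInter hC) hx hxC]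
  simp only [h.limitingNormalCone_preimage hf (hC _) hx (mem_iInter.1 hxC _)]

end RegularNear

theorem theorem3p4
    {X Y : Type*} [NormedAddCommGroup X] [NormedSpace ℝ X] [CompleteSpace X]
    [NormedAddCommGroup Y] [NormedSpace ℝ Y] (hY : IsAsplund Y)
    (f : X → Y) (hf : ContDiff ℝ 1 f)
    {m : ℕ} (C : Fin m → Set Y)
    (hC_closed : ∀ i, IsClosed (C i)) (hC_convex : ∀ i, Convex ℝ (C i))
    (hC_nonempty : (⋂ i, C i).Nonempty)
    (A : Fin m → Set X) (hA : ∀ i, A i = f ⁻¹' (C i))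
    (xbar : X) (hxbar : xbar ∈ ⋂ i, A i)
    (hsurj : Function.Surjective (fderiv ℝ f xbar)) :
    List.TFAE [
      SubtransversalAt A xbar,
      ∃ τ > (0 : ℝ), ∃ δ > (0 : ℝ), ∀ x ∈ (⋂ i, A i) ∩ ball xbar δ,
        StrongFrechetCHIPAt A x ∧ PropertyGWith τ (fun i => frechetNormalCone (A i) x),
      ∃ τ > (0 : ℝ), ∃ δ > (0 : ℝ), ∀ x ∈ (⋂ i, A i) ∩ ball xbar δ,
        StrongLimitingCHIPAt A x ∧ PropertyGWith τ (fun i => limitingNormalCone (A i) x)] := by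
  have : CompleteSpace Y := hY.1
  obtain rfl : A = fun i => f ⁻¹' C i := funext hA
  obtain ⟨κ, L, ρ, h⟩ := exists_regularNear hf hsurj
  have hρ := h.radius_pos
  rw [← preimage_iInter] at hxbar
  tfae_have 1 → 2 := h.strongFrechetCHIP_and_propertyG_of_subtransversalAt hf hC_convex hxbar
  tfae_have 2 → 1 := by
    rintro ⟨τ, hτ, δ, hδ, hG⟩
    exact h.subtransversalAt_of_strongFrechetCHIP_and_propertyG hf hC_closed hC_convex hxbar hτ hδ
      hG
  tfae_have 2 → 3 := by
    rintro ⟨τ, hτ, δ, hδ, hG⟩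
    refine ⟨τ, hτ, min δ ρ, lt_min hδ hρ, fun x hx => ?_⟩
    have hx' := lt_min_iff.1 (mem_ball.1 hx.2)
    refine (h.strongLimitingCHIP_and_propertyG_iff hf hC_convex hx'.2 ?_ τ).2 (hG x ⟨hx.1, hx'.1⟩)
    simpa using hx.1
  tfae_have 3 → 2 := by
    rintro ⟨τ, hτ, δ, hδ, hG⟩
    refine ⟨τ, hτ, min δ ρ, lt_min hδ hρ, fun x hx => ?_⟩
    have hx' := lt_min_iff.1 (mem_ball.1 hx.2)
    refine (h.strongLimitingCHIP_and_propertyG_iff hf hC_convex hx'.2 ?_ τ).1 (hG x ⟨hx.1, hx'.1⟩)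
    simpa using hx.1
  tfae_finish
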